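/- **Proposition.** Let $S$ be a (small) finite-limit sketch: a directed graph with a set of diagrams in it and a set of cones in it over finite diagrams. A *model* of $S$ in a category is a graph homomorphism from the graph of $S$ to it that takes the diagrams of $S$ to commutative diagrams and the cones of $S$ to limit cones. Let $\mathrm{CatTh}[\mathbf{FinLim},S]$ be the following category. Its objects are the finite diagrams $X$ in the image of the graph of $S$, that is, in the graph of $S$ with two parallel arrows identified when every model of $S$ in $\mathbf{Set}$ identifies them. An arrow $X\to Y$ is a family of functions $\lim (M\circ X)\to\lim (M\circ Y)$, one for each model $M$ of $S$ in $\mathbf{Set}$, natural in $M$. Let $U : S\to \mathrm{CatTh}[\mathbf{FinLim},S]$ send a node to the one-point diagram at it, and an arrow $f$ to the family $(M(f))_M$. Each object $X$ is the vertex of an evident cone over the diagram $U\circ X$ ("the formal cone of $X$"). 1. $\mathrm{CatTh}[\mathbf{FinLim},S]$ is a categorial theory of $S$ with universal model $U$: it has limits of finite diagrams, $U$ is a model of $S$, and for every model $M$ of $S$ in $\mathbf{Set}$ there is a finite-limit-preserving functor $F_M:\mathrm{CatTh}[\mathbf{FinLim},S]\to\mathbf{Set}$ with $F_M\circ U\cong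 M$, and $F_M$ is unique up to natural isomorphism. 2. $\mathrm{CatTh}[\mathbf{FinLim},S]$ has a system of canonical finite limits: a choice, for every finite diagram $\delta$ in it, of a limit cone $\mathrm{LimCone}[\delta]:\mathrm{Lim}[\delta]\triangleleft\delta$ such that $\mathrm{LimCone}[U\circ X]$ is the formal cone of $X$ for every object $X$ (so every object is the canonical limit of a diagram in the sketch). 3. Fix any such system, and call *canonical* the cones $\mathrm{LimCone}[\delta]$ and the images under $U$ of the cones of $S$. Then every object and every arrow of $\mathrm{CatTh}[\mathbf{FinLim},S]$ is obtained by repeated application of these rules: - ($\exists$OB) $U(c)$ is constructed, for every node $c$ of $S$; - ($\exists$ARR) $U(f)$ is constructed, for every arrow $f$ of $S$; - ($\exists$COMP) from $f:a\to b$ and $g:b\to c$ construct $g\circ f$; - ($\exists$ID) from an object $c$ construct $\mathrm{Id}[c]$; - ($\exists$LIM) from the objects and arrows of a finite diagram $\delta$ construct the vertex and the projections of the canonical limit cones over $\delta$; - ($\exists$FIA) from the objects and arrows of a finite diagram $\delta$, and the vertex and projections of a cone $\Theta$ over $\delta$ whose commutativity has been derived, construct the unique arrow from the vertex of $\Theta$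 to the vertex of a canonical limit cone over $\delta$ that commutes with the projections. Here the commutativity of a diagram that consists of two parallel paths of constructed arrows is derived by these rules: an arrow $f$ commutes with itself (REF); if $p,q$ commute and $r,q$ commute, then so do $p,r$ (TRANS); $U$ takes every diagram of $S$ to a commutative diagram ($\exists$DIAG); the path $f,g$ commutes with $g\circ f$ (COMPDIAG); the paths $g,\mathrm{Id}$ and $\mathrm{Id},g$ commute with $g$ (IDL, IDR); the path $f,\,h\circ g$ commutes with the path $g\circ f,\,h$ (ASSOC); canonical limit cones commute; the fill-in arrow of $\exists$FIA followed by a projection commutes with the corresponding projection of $\Theta$ (CFIA); and two arrows $h,k$ to the vertex of a canonical limit cone that both commute with its projections and those of one cone commute with each other (!FIA). In other words, the least collection of objects and arrows of $\mathrm{CatTh}[\mathbf{FinLim},S]$ that is closed under these rules consists of all of them: the rules define the theory recursively. -/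

import Mathlib

open CategoryTheory

universe u v w v₁ w₁

/-! ### Finite graphs, diagrams and cones -/

/-- A finite (directed multi-)graph, in standard form: the nodes are `0, …, nodes - 1`, and there
are `arrows i j` arrows from `i` to `j`. Every finite graph is isomorphic to one of this form. -/
structure FinGraph where
  nodes : ℕ
  arrows : Fin nodes → Fin nodes → ℕ

/-- The type of nodes of a finite graph. -/
def FinGraph.Node (I : FinGraph) : Type := Fin I.nodes

instance (I : FinGraph) : Quiver.{0} I.Node where
  Hom i j := Fin (I.arrows i j)

/-- The graph with one node and no arrows. -/
def FinGraph.point : FinGraph where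
  nodes := 1
  arrows _ _ := 0

/-- The node of the one-point graph. -/
def FinGraph.pointNode : FinGraph.point.Node := (0 : Fin 1)

/-- A (not necessarily commutative) cone in a graph `G` over a finite diagram `δ : I → G`: a vertex
and an arrow from it to `δ i` for each node `i` of `I`. -/
structure GCone {G : Type w} [Quiver.{v} G] {I : FinGraph} (δ : I.Node ⥤q G) where
  vertex : G
  proj : ∀ i : I.Node, vertex ⟶ δ.obj i

/-- The image of a cone under a graph homomorphism. -/
def GCone.map {G : Type w} [Quiver.{v} G] {H : Type w₁} [Quiver.{v₁} H] {I : FinGraph}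
    {δ : I.Node ⥤q G} (c : GCone δ) (F : G ⥤q H) : GCone (δ ⋙q F) where
  vertex := F.obj c.vertex
  proj i := F.map (c.proj i)

/-- A cone in a category is commutative. -/
def GCone.Commutes {C : Type w} [Category.{v} C] {I : FinGraph} {δ : I.Node ⥤q C}
    (c : GCone δ) : Prop :=
  ∀ (i j : I.Node) (a : i ⟶ j), c.proj i ≫ δ.map a = c.proj j

/-- A cone in a category is a limit cone: it is commutative, and every commutative cone over the
same diagram factors through it by exactly one arrow. -/
def GCone.IsLimit {C : Type w} [Category.{v} C] {I : FinGraph} {δ : I.Node ⥤q C}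
    (c : GCone δ) : Prop :=
  c.Commutes ∧ ∀ t : GCone δ, t.Commutes →
    ∃! h : t.vertex ⟶ c.vertex, ∀ i, h ≫ c.proj i = t.proj i

/-- A diagram in a category commutes: any two parallel paths of the shape graph have the same
composite (an empty path having an identity as its composite). -/
def DiagramCommutes {J : Type w₁} [Quiver.{v₁} J] {C : Type w} [Category.{v} C]
    (δ : J ⥤q C) : Prop :=
  ∀ (i j : J) (p q : Quiver.Path i j), composePath (δ.mapPath p) = composePath (δ.mapPath q)

/-- A functor preserves all limits of finite diagrams. -/
def PreservesFinLim {C : Type w} [Category.{v} C] {D : Type w₁} [Category.{v₁} D]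
    (F : C ⥤ D) : Prop :=
  ∀ (I : FinGraph) (δ : I.Node ⥤q C) (c : GCone δ), c.IsLimit → (c.map F.toPrefunctor).IsLimit

/-! ### Finite-limit sketches and their models -/

/-- A finite-limit sketch: a graph, a set of diagrams in it, and a set of cones in it over finite
diagrams. -/
structure FinLimSketch where
  Node : Type u
  [quiver : Quiver.{u} Node]
  DiagIdx : Type u
  diagShape : DiagIdx → Type u
  [diagQuiver : ∀ d, Quiver.{u} (diagShape d)]
  diag : ∀ d, diagShape d ⥤q Node
  ConeIdx : Type u
  coneShape : ConeIdx → FinGraph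
  coneBase : ∀ c, (coneShape c).Node ⥤q Node
  cone : ∀ c, GCone (coneBase c)

attribute [instance] FinLimSketch.quiver FinLimSketch.diagQuiver

namespace FinLimSketch

/-- A graph homomorphism from the graph of a sketch to a category is a model of the sketch: it
takes the diagrams to commutative diagrams and the cones to limit cones. -/
def IsModel (S : FinLimSketch.{u}) {C : Type w} [Category.{v} C] (M : S.Node ⥤q C) : Prop :=
  (∀ d, DiagramCommutes (S.diag d ⋙q M)) ∧ ∀ c, ((S.cone c).map M).IsLimit

/-- A model of a sketch in the category of sets. -/
structure SetModel (S : FinLimSketch.{u}) where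
  toPre : S.Node ⥤q Type u
  isModel : S.IsModel toPre

/-- A morphism of set-valued models. -/
structure SetModelHom {S : FinLimSketch.{u}} (M N : S.SetModel) where
  app : ∀ n : S.Node, M.toPre.obj n → N.toPre.obj n
  naturality : ∀ {a b : S.Node} (f : a ⟶ b) (x : M.toPre.obj a),
    app b (M.toPre.map f x) = N.toPre.map f (app a x)

/-! ### The categorial theory of a sketch

An object is a finite diagram of the form `UnivMod ∘ δ`, with `δ` a diagram in the graph of the
sketch; it stands for the limit of that diagram. An arrow from `X` to `Y` is an operation
`lim (M ∘ X) → lim (M ∘ Y)` given for all set-valued models `M` and natural in `M`. As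
`M ↦ lim (M ∘ X)` is represented by the model that is freely generated by an element of
`lim (M ∘ X)`, this is the opposite of the full subcategory of such finitely presented models. -/

/-- Two arrows of the graph of `S` are identified if every set-valued model identifies them. -/
def arrowSetoid (S : FinLimSketch.{u}) (a b : S.Node) : Setoid (a ⟶ b) where
  r f g := ∀ M : S.SetModel, M.toPre.map f = M.toPre.map g
  iseqv := ⟨fun _ _ => rfl, fun h M => (h M).symm, fun h k M => (h M).trans (k M)⟩

/-- The nodes of `S`, as nodes of the image of the graph of `S` in the theory. -/
def ImNode (S : FinLimSketch.{u}) : Type u := S.Node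

/-- The image of the graph of `S` in the theory: its arrows are those of `S`, up to the
identifications made by all models. -/
instance (S : FinLimSketch.{u}) : Quiver.{u} S.ImNode where
  Hom a b := Quotient (S.arrowSetoid a b)

/-- The graph homomorphism from the graph of `S` onto its image. -/
def toIm (S : FinLimSketch.{u}) : S.Node ⥤q S.ImNode where
  obj n := n
  map f := Quotient.mk _ f

/-- A set-valued model, on the image graph. -/
def SetModel.im {S : FinLimSketch.{u}} (M : S.SetModel) : S.ImNode ⥤q Type u where
  obj n := M.toPre.obj n
  map {a b} e := Quotient.lift (s := S.arrowSetoid a b) (fun f => M.toPre.map f)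
    (fun _ _ h => h M) e

/-- The objects of the theory. -/
structure Theory (S : FinLimSketch.{u}) where
  shape : FinGraph
  diag : shape.Node ⥤q S.ImNode

/-- The set `lim (M ∘ X)`, as the set of compatible families. -/
def Sec {S : FinLimSketch.{u}} (M : S.SetModel) (X : S.Theory) : Type u :=
  { x : ∀ i : X.shape.Node, M.im.obj (X.diag.obj i) //
    ∀ (i j : X.shape.Node) (a : i ⟶ j), M.im.map (X.diag.map a) (x i) = x j }

/-- A morphism of models is compatible with the arrows of the image graph. -/
theorem SetModelHom.im_naturality {S : FinLimSketch.{u}} {M N : S.SetModel}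
    (h : SetModelHom M N) {a b : S.ImNode} (e : a ⟶ b) (x : M.im.obj a) :
    h.app b (M.im.map e x) = N.im.map e (h.app a x) := by
  induction e using Quotient.inductionOn with
  | h f => exact h.naturality f x

/-- The function `lim (M ∘ X) → lim (N ∘ X)` induced by a morphism of models. -/
def SetModelHom.sec {S : FinLimSketch.{u}} {M N : S.SetModel} (h : SetModelHom M N)
    (X : S.Theory) (x : Sec M X) : Sec N X :=
  ⟨fun i => h.app _ (x.1 i), fun i j a => by rw [← h.im_naturality, x.2 i j a]⟩

/-- The arrows of the theory. -/
@[ext]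
structure TheoryHom {S : FinLimSketch.{u}} (X Y : S.Theory) where
  app : ∀ M : S.SetModel, Sec M X → Sec M Y
  naturality : ∀ {M N : S.SetModel} (h : SetModelHom M N) (x : Sec M X),
    app N (h.sec X x) = h.sec Y (app M x)

/-- The categorial theory of `S`. -/
instance (S : FinLimSketch.{u}) : Category.{u + 1} S.Theory where
  Hom X Y := TheoryHom X Y
  id _ := ⟨fun _ x => x, fun _ _ => rfl⟩
  comp f g := ⟨fun M x => g.app M (f.app M x), fun h x => by rw [f.naturality, g.naturality]⟩

/-- A node of `S` as an object of the theory: the limit of the one-point diagram. -/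
def single (S : FinLimSketch.{u}) (n : S.ImNode) : S.Theory where
  shape := FinGraph.point
  diag := { obj := fun _ => n, map := fun a => Fin.elim0 a }

/-- An element of `M n`, as a compatible family over the one-point diagram. -/
def secSingle {S : FinLimSketch.{u}} (M : S.SetModel) {n : S.ImNode} (x : M.im.obj n) :
    Sec M (S.single n) :=
  ⟨fun _ => x, fun _ _ a => Fin.elim0 a⟩

/-- The inclusion of the image graph of `S` in the theory. -/
def imIncl (S : FinLimSketch.{u}) : S.ImNode ⥤q S.Theory where
  obj n := S.single n
  map e := TheoryHom.mk (fun M x => secSingle M (M.im.map e (x.1 FinGraph.pointNode)))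
    (fun h _ => Subtype.ext (funext fun _ => (h.im_naturality e _).symm))

/-- The universal model of `S`. -/
def univMod (S : FinLimSketch.{u}) : S.Node ⥤q S.Theory := S.toIm ⋙q S.imIncl

/-- The diagram in the theory that an object of the theory is the formal limit of. -/
def Theory.diagram {S : FinLimSketch.{u}} (X : S.Theory) : X.shape.Node ⥤q S.Theory :=
  X.diag ⋙q S.imIncl

/-- The cone over that diagram which is given by the evident projections
`lim (M ∘ X) → M (X i)`. -/
def Theory.formalCone {S : FinLimSketch.{u}} (X : S.Theory) : GCone X.diagram where
  vertex := X
  proj i := TheoryHom.mk (fun M x => secSingle M (x.1 i)) (fun _ _ => rfl)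

/-- A category `C` with a graph homomorphism `U` to it from the graph of `S` is a categorial theory
of `S` with universal model `U`: `C` has limits of finite diagrams, `U` is a model, and every
set-valued model of `S` is, up to isomorphism, the restriction along `U` of a functor that
preserves finite limits, which is determined uniquely up to natural isomorphism. -/
structure IsCategorialTheory (S : FinLimSketch.{u}) {C : Type w} [Category.{v} C]
    (U : S.Node ⥤q C) : Prop where
  hasLimits : ∀ (I : FinGraph) (δ : I.Node ⥤q C), ∃ c : GCone δ, c.IsLimit
  isModel : S.IsModel U
  extend : ∀ M : S.SetModel, ∃ F : C ⥤ Type u, PreservesFinLim F ∧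
    ∃ φ : ∀ n : S.Node, F.obj (U.obj n) ≅ M.toPre.obj n,
      ∀ {a b : S.Node} (f : a ⟶ b),
        F.map (U.map f) ≫ (φ b).hom = (φ a).hom ≫ M.toPre.map f
  unique : ∀ F G : C ⥤ Type u, PreservesFinLim F → PreservesFinLim G →
    (∃ φ : ∀ n : S.Node, F.obj (U.obj n) ≅ G.obj (U.obj n),
      ∀ {a b : S.Node} (f : a ⟶ b),
        F.map (U.map f) ≫ (φ b).hom = (φ a).hom ≫ G.map (U.map f)) →
    Nonempty (F ≅ G)

/-- A choice of canonical finite limits in the theory: a limit cone `LimCone[δ]` for each finite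
diagram `δ`, such that the canonical limit of a diagram that comes from the graph of `S` is the
object of the theory that is that diagram. -/
structure CanonicalLimits (S : FinLimSketch.{u}) where
  limCone : ∀ {I : FinGraph} (δ : I.Node ⥤q S.Theory), GCone δ
  isLimit : ∀ {I : FinGraph} (δ : I.Node ⥤q S.Theory), (limCone δ).IsLimit
  formal : ∀ X : S.Theory, limCone X.diagram = X.formalCone

/-- The canonical limit cones of the theory: the cones `LimCone[δ]`, and the cones of `S`, which
the universal model, being a morphism of sketches, takes to canonical limit cones. -/
inductive IsCanonical {S : FinLimSketch.{u}} (L : S.CanonicalLimits) :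
    ∀ {I : FinGraph} {δ : I.Node ⥤q S.Theory}, GCone δ → Prop
  | lim {I : FinGraph} (δ : I.Node ⥤q S.Theory) : IsCanonical L (L.limCone δ)
  | sketch (c : S.ConeIdx) : IsCanonical L ((S.cone c).map S.univMod)

/-! ### The rules of construction

`ConstrOb L X` and `ConstrArr L f` say that the object `X` and the arrow `f` are obtained by
repeated application of the rules; `ConstrComm L p q` says that it follows by the rules that the
diagram consisting of the parallel paths `p` and `q` commutes. -/

mutual

/-- The objects that the rules construct. -/
inductive ConstrOb {S : FinLimSketch.{u}} (L : S.CanonicalLimits) : S.Theory → Prop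
  /-- Rule `∃OB`. -/
  | ob (c : S.Node) : ConstrOb L (S.univMod.obj c)
  /-- Rule `∃LIM`, the vertex. -/
  | lim {I : FinGraph} (δ : I.Node ⥤q S.Theory)
      (hob : ∀ i, ConstrOb L (δ.obj i))
      (harr : ∀ (i j : I.Node) (a : i ⟶ j), ConstrArr L (δ.map a))
      (c : GCone δ) (hc : IsCanonical L c) : ConstrOb L c.vertex

/-- The arrows that the rules construct. -/
inductive ConstrArr {S : FinLimSketch.{u}} (L : S.CanonicalLimits) :
    ∀ {X Y : S.Theory}, (X ⟶ Y) → Prop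
  /-- Rule `∃ARR`. -/
  | arr {a b : S.Node} (f : a ⟶ b) : ConstrArr L (S.univMod.map f)
  /-- Rule `∃COMP`. -/
  | comp {X Y Z : S.Theory} (f : X ⟶ Y) (g : Y ⟶ Z)
      (hf : ConstrArr L f) (hg : ConstrArr L g) : ConstrArr L (f ≫ g)
  /-- Rule `∃ID`. -/
  | id (X : S.Theory) (hX : ConstrOb L X) : ConstrArr L (𝟙 X)
  /-- Rule `∃LIM`, the projections. -/
  | proj {I : FinGraph} (δ : I.Node ⥤q S.Theory)
      (hob : ∀ i, ConstrOb L (δ.obj i))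
      (harr : ∀ (i j : I.Node) (a : i ⟶ j), ConstrArr L (δ.map a))
      (c : GCone δ) (hc : IsCanonical L c) (i : I.Node) : ConstrArr L (c.proj i)
  /-- Rule `∃FIA`: the fill-in arrow `h` of a commutative cone `t`. -/
  | fillin {I : FinGraph} (δ : I.Node ⥤q S.Theory)
      (hob : ∀ i, ConstrOb L (δ.obj i))
      (harr : ∀ (i j : I.Node) (a : i ⟶ j), ConstrArr L (δ.map a))
      (c : GCone δ) (hc : IsCanonical L c)
      (t : GCone δ) (hv : ConstrOb L t.vertex) (ht : ∀ i, ConstrArr L (t.proj i))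
      (hcomm : ∀ (i j : I.Node) (a : i ⟶ j),
        ConstrComm L ((t.proj i).toPath.cons (δ.map a)) (t.proj j).toPath)
      (h : t.vertex ⟶ c.vertex) (hh : ∀ i, h ≫ c.proj i = t.proj i) : ConstrArr L h

/-- The commutative diagrams that the rules construct. -/
inductive ConstrComm {S : FinLimSketch.{u}} (L : S.CanonicalLimits) :
    ∀ {X Y : S.Theory}, Quiver.Path X Y → Quiver.Path X Y → Prop
  /-- Rule `REF`. -/
  | ref {X Y : S.Theory} (f : X ⟶ Y) (hf : ConstrArr L f) : ConstrComm L f.toPath f.toPath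
  /-- Rule `TRANS`. -/
  | trans {X Y : S.Theory} (p q r : Quiver.Path X Y)
      (hpq : ConstrComm L p q) (hrq : ConstrComm L r q) : ConstrComm L p r
  /-- Rule `∃DIAG`. -/
  | diag (d : S.DiagIdx) (i j : S.diagShape d) (p q : Quiver.Path i j) :
      ConstrComm L ((S.diag d ⋙q S.univMod).mapPath p) ((S.diag d ⋙q S.univMod).mapPath q)
  /-- Rule `COMPDIAG`. -/
  | compdiag {X Y Z : S.Theory} (f : X ⟶ Y) (g : Y ⟶ Z)
      (hf : ConstrArr L f) (hg : ConstrArr L g) :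
      ConstrComm L (f.toPath.cons g) (f ≫ g).toPath
  /-- Rule `IDL`. -/
  | idl {X Y : S.Theory} (g : X ⟶ Y) (hY : ConstrOb L Y) (hg : ConstrArr L g) :
      ConstrComm L (g.toPath.cons (𝟙 Y)) g.toPath
  /-- Rule `IDR`. -/
  | idr {X Y : S.Theory} (f : X ⟶ Y) (hX : ConstrOb L X) (hf : ConstrArr L f) :
      ConstrComm L ((𝟙 X : X ⟶ X).toPath.cons f) f.toPath
  /-- Rule `ASSOC`. -/
  | assoc {W X Y Z : S.Theory} (f : W ⟶ X) (g : X ⟶ Y) (h : Y ⟶ Z)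
      (hf : ConstrArr L f) (hg : ConstrArr L g) (hh : ConstrArr L h) :
      ConstrComm L (f.toPath.cons (g ≫ h)) ((f ≫ g).toPath.cons h)
  /-- Rule `∃LIM`, commutativity of the canonical limit cone. -/
  | lim {I : FinGraph} (δ : I.Node ⥤q S.Theory)
      (hob : ∀ i, ConstrOb L (δ.obj i))
      (harr : ∀ (i j : I.Node) (a : i ⟶ j), ConstrArr L (δ.map a))
      (c : GCone δ) (hc : IsCanonical L c) (i j : I.Node) (a : i ⟶ j) :
      ConstrComm L ((c.proj i).toPath.cons (δ.map a)) (c.proj j).toPath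
  /-- Rule `CFIA`: the fill-in arrow commutes with the projections. -/
  | cfia {I : FinGraph} (δ : I.Node ⥤q S.Theory)
      (hob : ∀ i, ConstrOb L (δ.obj i))
      (harr : ∀ (i j : I.Node) (a : i ⟶ j), ConstrArr L (δ.map a))
      (c : GCone δ) (hc : IsCanonical L c)
      (t : GCone δ) (hv : ConstrOb L t.vertex) (ht : ∀ i, ConstrArr L (t.proj i))
      (hcomm : ∀ (i j : I.Node) (a : i ⟶ j),
        ConstrComm L ((t.proj i).toPath.cons (δ.map a)) (t.proj j).toPath)
      (h : t.vertex ⟶ c.vertex) (hh : ∀ i, h ≫ c.proj i = t.proj i) (i : I.Node) :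
      ConstrComm L (h.toPath.cons (c.proj i)) (t.proj i).toPath
  /-- Rule `!FIA`: two arrows that commute with the projections are equal. -/
  | unique_fia {I : FinGraph} (δ : I.Node ⥤q S.Theory)
      (hob : ∀ i, ConstrOb L (δ.obj i))
      (harr : ∀ (i j : I.Node) (a : i ⟶ j), ConstrArr L (δ.map a))
      (c : GCone δ) (hc : IsCanonical L c)
      (t : GCone δ) (hv : ConstrOb L t.vertex) (ht : ∀ i, ConstrArr L (t.proj i))
      (h k : t.vertex ⟶ c.vertex) (hh : ConstrArr L h) (hk : ConstrArr L k)
      (hcommh : ∀ i, ConstrComm L (h.toPath.cons (c.proj i)) (t.proj i).toPath)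
      (hcommk : ∀ i, ConstrComm L (k.toPath.cons (c.proj i)) (t.proj i).toPath) :
      ConstrComm L h.toPath k.toPath

end

end FinLimSketch

-- Arrows of the theory are defined semantically, as natural operations. The key fact is that they
-- are syntactic all the same: an arrow from `X` to a node arises from the projections of `X` by
-- composing with arrows of `S` and by filling in through cones of `S` (`exists_denotes`, used in
-- the form `hom_node_induction`). Indeed, the arrows generated in this way form a small model of
-- `S`, in which the projections constitute a generic element of `lim (M ∘ X)`. Every element of
-- `lim (M ∘ X)`, for any `M`, is the image of the generic one under a morphism of models. By
-- naturality an operation is therefore fixed by its value at the generic element, and that value is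
-- a generated arrow. Arrows to an arbitrary object reduce to arrows to nodes, because each object
-- is the limit of its own diagram of nodes (`Theory.formalCone_isLimit`).
--
-- Both the recursive description of the theory (`constrArr`) and the uniqueness of extensions of
-- models (`exists_natTrans`) are inductions along this generation.
--
-- For the existence of limits, the same induction shows that the graph of an arrow to a node is cut
-- out by finitely many equations, with auxiliary variables that are uniquely determined
-- (`definable_isGraph`). The limit at `M` of a finite diagram of objects is then a relation of this
-- kind. A finite system of equations becomes, once equated variables are merged, a finite diagram
-- in the image graph, that is, an object (`Definable.exists_represents`). The resulting cone is a
-- limit at every model, hence a limit in the theory, and evaluation at `M` preserves it; this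
-- evaluation is the required extension of `M`.
--
-- Canonical limits can be chosen because an object is recovered from its diagram in the theory
-- (`Theory.eq_of_diagram_eq`), so the prescribed values never conflict.

/-! ### Limit cones of types -/

/-- A cone of types is a limit cone iff it is commutative and every compatible family comes from a
unique element of the vertex. -/
theorem GCone.isLimit_type_iff {I : FinGraph} {δ : I.Node ⥤q Type w} (c : GCone δ) :
    c.IsLimit ↔ c.Commutes ∧ ∀ x : (∀ i, δ.obj i),
      (∀ (i j : I.Node) (a : i ⟶ j), δ.map a (x i) = x j) →
        ∃! z : c.vertex, ∀ i, c.proj i z = x i := by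
  refine and_congr_right fun _ => ⟨fun h x hx => ?_, fun h t ht => ?_⟩
  -- Compatible families are exactly the commutative cones with a one-point vertex.
  · obtain ⟨k, hk, hk'⟩ := h ⟨PUnit, fun i => ↾fun _ => x i⟩
      (fun i j a => by ext; exact hx i j a)
    refine ⟨k PUnit.unit, fun i => ConcreteCategory.congr_hom (hk i) PUnit.unit, fun z hz => ?_⟩
    exact ConcreteCategory.congr_hom
      (hk' (↾fun _ => z) fun i => by ext; exact hz i) PUnit.unit
  · choose k hk hk' using fun y : t.vertex => h (fun i => t.proj i y)
      (fun i j a => ConcreteCategory.congr_hom (ht i j a) y)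
    refine ⟨↾k, fun i => by ext y; exact hk y i, fun l hl => ?_⟩
    ext y
    exact hk' y _ fun i => ConcreteCategory.congr_hom (hl i) y

/-- The projections of a limit cone are jointly monic. -/
theorem GCone.IsLimit.hom_ext {C : Type w} [Category.{v} C] {I : FinGraph} {δ : I.Node ⥤q C}
    {c : GCone δ} (hc : c.IsLimit) {X : C} {f g : X ⟶ c.vertex}
    (h : ∀ i, f ≫ c.proj i = g ≫ c.proj i) : f = g :=
  (hc.2 ⟨X, fun i => g ≫ c.proj i⟩ fun i j a => by
    rw [Category.assoc, hc.1 i j a]).unique h fun _ => rfl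

namespace FinLimSketch

variable {S : FinLimSketch.{u}}

/-! ### Evaluation of the theory at a model -/

/-- The operation on the sets `lim (M ∘ X)` that an arrow of the theory is. -/
def Theory.act {X Y : S.Theory} (f : X ⟶ Y) (M : S.SetModel) : Sec M X → Sec M Y :=
  TheoryHom.app f M

theorem Theory.hom_ext {X Y : S.Theory} {f g : X ⟶ Y}
    (h : ∀ M x, Theory.act f M x = Theory.act g M x) : f = g :=
  TheoryHom.ext (funext fun M => funext fun x => h M x)

theorem Theory.act_comp {X Y Z : S.Theory} (f : X ⟶ Y) (g : Y ⟶ Z) (M : S.SetModel)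
    (x : Sec M X) : Theory.act (f ≫ g) M x = Theory.act g M (Theory.act f M x) := rfl

theorem Theory.act_naturality {X Y : S.Theory} (f : X ⟶ Y) {M N : S.SetModel}
    (h : SetModelHom M N) (x : Sec M X) :
    Theory.act f N (h.sec X x) = h.sec Y (Theory.act f M x) :=
  TheoryHom.naturality f h x

/-- The value of an arrow to a node. -/
def Theory.val {X : S.Theory} {n : S.ImNode} (f : X ⟶ S.single n) (M : S.SetModel)
    (x : Sec M X) : M.im.obj n :=
  (Theory.act f M x).1 FinGraph.pointNode

theorem secSingle_eta {M : S.SetModel} {n : S.ImNode} (x : Sec M (S.single n)) :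
    secSingle M (x.1 FinGraph.pointNode) = x := by
  refine Subtype.ext (funext fun i => ?_)
  have hi : i = FinGraph.pointNode := Subsingleton.elim (α := Fin 1) i 0
  rw [hi]
  rfl

theorem Theory.act_eq_secSingle_val {X : S.Theory} {n : S.ImNode} (f : X ⟶ S.single n)
    (M : S.SetModel) (x : Sec M X) : Theory.act f M x = secSingle M (Theory.val f M x) :=
  (secSingle_eta _).symm

theorem Theory.hom_single_ext {X : S.Theory} {n : S.ImNode} {f g : X ⟶ S.single n}
    (h : ∀ M x, Theory.val f M x = Theory.val g M x) : f = g :=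
  Theory.hom_ext fun M x => by
    rw [Theory.act_eq_secSingle_val, Theory.act_eq_secSingle_val, h]

theorem Theory.val_naturality {X : S.Theory} {n : S.ImNode} (f : X ⟶ S.single n)
    {M N : S.SetModel} (h : SetModelHom M N) (x : Sec M X) :
    Theory.val f N (h.sec X x) = h.app n (Theory.val f M x) := by
  rw [Theory.val, Theory.act_naturality]
  rfl

theorem Theory.val_comp_univMod {X : S.Theory} {a b : S.Node} (f : X ⟶ S.univMod.obj a)
    (e : a ⟶ b) (M : S.SetModel) (x : Sec M X) :
    Theory.val (f ≫ S.univMod.map e) M x = M.toPre.map e (Theory.val f M x) := rfl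

/-- The node of `S` at a point of the diagram. -/
def Theory.label (X : S.Theory) (i : X.shape.Node) : S.Node := X.diag.obj i

/-- The `i`-th projection from an object of the theory. -/
def Theory.proj (X : S.Theory) (i : X.shape.Node) : X ⟶ S.univMod.obj (X.label i) :=
  X.formalCone.proj i

/-- Every arrow of the diagram of `X` comes from an arrow of `S`. -/
theorem Theory.exists_arrow (X : S.Theory) {i j : X.shape.Node} (a : i ⟶ j) :
    ∃ f : X.label i ⟶ X.label j, X.diag.map a = S.toIm.map f :=
  (Quotient.exists_rep (X.diag.map a)).imp fun _ h => h.symm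

/-- Evaluation of the theory at a set-valued model. -/
def evalAt (M : S.SetModel) : S.Theory ⥤ Type u where
  obj X := Sec M X
  map f := ↾(Theory.act f M)
  map_id _ := rfl
  map_comp _ _ := rfl

/-- A cone in the theory is a limit cone if all set-valued models take it to a limit cone. -/
theorem isLimit_of_evalAt {I : FinGraph} {δ : I.Node ⥤q S.Theory} (c : GCone δ)
    (h : ∀ M : S.SetModel, (c.map (evalAt M).toPrefunctor).IsLimit) : c.IsLimit := by
  have hlim := fun M => (GCone.isLimit_type_iff _).1 (h M)
  refine ⟨fun i j a => Theory.hom_ext fun M x =>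
    ConcreteCategory.congr_hom ((hlim M).1 i j a) x, fun t ht => ?_⟩
  choose k hk hk' using fun (M : S.SetModel) (y : Sec M t.vertex) =>
    (hlim M).2 (fun i => Theory.act (t.proj i) M y)
      (fun i j a => by
        change Theory.act (δ.map a) M _ = _
        rw [← Theory.act_comp, ht i j a])
  refine ⟨TheoryHom.mk k fun {M N} f x => ?_, fun i => Theory.hom_ext fun M x => hk M x i,
    fun l hl => Theory.hom_ext fun M x => hk' M x _ fun i => ?_⟩
  -- The mediating functions are chosen model by model; their naturality follows from uniqueness at
  -- the target model `N`.
  · refine (hk' N _ _ fun i => ?_).symm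
    exact (Theory.act_naturality (c.proj i) f (k M x)).trans
      ((congrArg (f.sec _) (hk M x i)).trans (Theory.act_naturality (t.proj i) f x).symm)
  · change Theory.act (c.proj i) M _ = _
    rw [← Theory.act_comp]
    exact congrArg (fun g => Theory.act g M x) (hl i)

/-- Every object is the limit of its diagram, at every model. -/
theorem Theory.formalCone_evalAt_isLimit (X : S.Theory) (M : S.SetModel) :
    (X.formalCone.map (evalAt M).toPrefunctor).IsLimit := by
  rw [GCone.isLimit_type_iff]
  refine ⟨fun i j a => ?_, fun x hx => ?_⟩
  · ext y
    exact congrArg (secSingle M) (y.2 i j a)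
  · refine ⟨⟨fun i => (x i).1 FinGraph.pointNode, fun i j a => ?_⟩, fun i => secSingle_eta _,
      fun z hz => Subtype.ext (funext fun i => ?_)⟩
    · exact congrArg (fun y : Sec M (S.single _) => y.1 FinGraph.pointNode) (hx i j a)
    · exact congrArg (fun y : Sec M (S.single _) => y.1 FinGraph.pointNode) (hz i)

/-- Every object is the limit of its diagram. -/
theorem Theory.formalCone_isLimit (X : S.Theory) : X.formalCone.IsLimit :=
  isLimit_of_evalAt _ X.formalCone_evalAt_isLimit

theorem Theory.proj_comp (X : S.Theory) {i j : X.shape.Node} {a : i ⟶ j}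
    {f : X.label i ⟶ X.label j} (h : X.diag.map a = S.toIm.map f) :
    X.proj i ≫ S.univMod.map f = X.proj j :=
  (congrArg (fun e => X.formalCone.proj i ≫ S.imIncl.map e) h.symm).trans
    (X.formalCone_isLimit.1 i j a)

/-- This reduces commutativity of a diagram under `univMod` to its commutativity in each model. -/
theorem val_composePath {X : S.Theory} {J : Type*} [Quiver J] (δ : J ⥤q S.Node) {i j : J}
    (p : Quiver.Path i j) (f : X ⟶ S.univMod.obj (δ.obj i)) (M : S.SetModel) (x : Sec M X) :
    Theory.val (f ≫ composePath ((δ ⋙q S.univMod).mapPath p)) M x =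
      composePath ((δ ⋙q M.toPre).mapPath p) (Theory.val f M x) := by
  induction p with
  | nil => rfl
  | cons p e ih =>
    have := congrArg (M.toPre.map (δ.map e)) ih
    exact this

/-- The universal model is a model. -/
theorem univMod_isModel (S : FinLimSketch.{u}) : S.IsModel S.univMod := by
  refine ⟨fun d i j p q => Theory.hom_single_ext fun M x => ?_, fun c => ?_⟩
  · have key := fun p : Quiver.Path i j =>
      val_composePath (S.diag d) p (𝟙 (S.univMod.obj ((S.diag d).obj i))) M x
    have := (key p).trans ((ConcreteCategory.congr_hom (M.isModel.1 d i j p q) _).trans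
      (key q).symm)
    rw [Category.id_comp, Category.id_comp] at this
    exact this
  · refine isLimit_of_evalAt _ fun M => ?_
    have hM := (GCone.isLimit_type_iff _).1 (M.isModel.2 c)
    rw [GCone.isLimit_type_iff]
    refine ⟨fun i j a => ?_, fun x hx => ?_⟩
    · ext y
      exact congrArg (secSingle M) (ConcreteCategory.congr_hom (hM.1 i j a) (y.1 _))
    · obtain ⟨z, hz, hz'⟩ := hM.2 (fun i => (x i).1 FinGraph.pointNode) fun i j a =>
        congrArg (fun y : Sec M (S.single _) => y.1 FinGraph.pointNode) (hx i j a)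
      refine ⟨secSingle M z, fun i => ?_, fun y hy => ?_⟩
      · exact (congrArg (secSingle M) (hz i)).trans (secSingle_eta _)
      · rw [← secSingle_eta y]
        refine congrArg (secSingle M) (hz' _ fun i => ?_)
        exact congrArg (fun y : Sec M (S.single _) => y.1 FinGraph.pointNode) (hy i)

/-! ### The model generated by an object of the theory

The arrows from `X` to the nodes that are generated by the projections under the arrows and the
cones of `S` form a small model of `S`. Evaluating a natural operation at its generic element shows
that all arrows from `X` to the nodes are generated in this way. -/

/-- The terms in variables `i : X.shape.Node` that are built from the arrows and cones of `S`. -/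
inductive GenTerm (X : S.Theory) : S.Node → Type u
  | var (i : X.shape.Node) : GenTerm X (X.label i)
  | app {a b : S.Node} (f : a ⟶ b) (t : GenTerm X a) : GenTerm X b
  | fill (c : S.ConeIdx) (t : ∀ i, GenTerm X ((S.coneBase c).obj i)) : GenTerm X (S.cone c).vertex

/-- The term denotes the given arrow of the theory. -/
def GenTerm.Denotes {X : S.Theory} : ∀ {n : S.Node}, GenTerm X n → (X ⟶ S.univMod.obj n) → Prop
  | _, .var i, g => g = X.proj i
  | _, .app f t, g => ∃ k, t.Denotes k ∧ g = k ≫ S.univMod.map f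
  | _, .fill c t, g => ∀ i, (t i).Denotes (g ≫ S.univMod.map ((S.cone c).proj i))

/-- A `fill` term denotes at most one arrow because `univMod` takes the cones of `S` to limit cones,
whose projections are jointly monic. It may denote none, since its components need not be
compatible. -/
theorem GenTerm.Denotes.unique {X : S.Theory} {n : S.Node} {t : GenTerm X n}
    {g g' : X ⟶ S.univMod.obj n} (h : t.Denotes g) (hg : t.Denotes g') : g = g' := by
  induction t with
  | var i => exact Eq.trans h (Eq.symm hg)
  | app f t ih =>
    obtain ⟨k, hk, rfl⟩ := h
    obtain ⟨k', hk', rfl⟩ := hg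
    rw [ih hk hk']
  | fill c t ih => exact (S.univMod_isModel.2 c).hom_ext fun i => ih i (h i) (hg i)

/-- The arrows from `X` to a node that are denoted by a term. -/
def GenHom (X : S.Theory) (n : S.Node) : Type (u + 1) :=
  { g : X ⟶ S.univMod.obj n // ∃ t : GenTerm X n, t.Denotes g }

/-- Hom-sets of the theory live in `Type (u + 1)`, as they quantify over all models. Terms live in
`Type u` and determine what they denote, so the denoted arrows can serve as elements of a model. -/
instance (X : S.Theory) (n : S.Node) : Small.{u} (GenHom X n) :=
  small_of_injective (β := GenTerm X n) (f := fun g => g.2.choose) fun g g' h => by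
    refine Subtype.ext (g.2.choose_spec.unique ?_)
    rw [show g.2.choose = g'.2.choose from h]
    exact g'.2.choose_spec

/-- The arrow denoted by an element of the model generated by `X`. -/
noncomputable def genArrow {X : S.Theory} {n : S.Node} (k : Shrink.{u} (GenHom X n)) :
    X ⟶ S.univMod.obj n :=
  ((equivShrink (GenHom X n)).symm k).1

/-- A denoted arrow as an element of the model generated by `X`. -/
noncomputable def genMk {X : S.Theory} {n : S.Node} (g : X ⟶ S.univMod.obj n)
    (h : ∃ t : GenTerm X n, t.Denotes g) : Shrink.{u} (GenHom X n) :=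
  equivShrink _ ⟨g, h⟩

theorem genArrow_genMk {X : S.Theory} {n : S.Node} (g : X ⟶ S.univMod.obj n)
    (h : ∃ t : GenTerm X n, t.Denotes g) : genArrow (genMk g h) = g :=
  congrArg Subtype.val ((equivShrink (GenHom X n)).symm_apply_apply ⟨g, h⟩)

theorem genArrow_denoted {X : S.Theory} {n : S.Node} (k : Shrink.{u} (GenHom X n)) :
    ∃ t : GenTerm X n, t.Denotes (genArrow k) :=
  ((equivShrink (GenHom X n)).symm k).2

theorem genArrow_injective {X : S.Theory} {n : S.Node} :
    Function.Injective (genArrow : Shrink.{u} (GenHom X n) → _) := fun _ _ h =>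
  (equivShrink _).symm.injective (Subtype.ext h)

/-- The graph homomorphism underlying the model generated by `X`. -/
noncomputable def genPre (X : S.Theory) : S.Node ⥤q Type u where
  obj n := Shrink.{u} (GenHom X n)
  map f := ↾fun k => genMk (genArrow k ≫ S.univMod.map f)
    ((genArrow_denoted k).imp' (GenTerm.app f) fun _ ht => ⟨_, ht, rfl⟩)

theorem genArrow_map {X : S.Theory} {a b : S.Node} (f : a ⟶ b) (k : (genPre X).obj a) :
    genArrow ((genPre X).map f k) = genArrow k ≫ S.univMod.map f :=
  genArrow_genMk _ _

theorem genArrow_composePath {X : S.Theory} {J : Type*} [Quiver J] (δ : J ⥤q S.Node) {i j : J}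
    (p : Quiver.Path i j) (k : (genPre X).obj (δ.obj i)) :
    genArrow (composePath ((δ ⋙q genPre X).mapPath p) k) =
      genArrow k ≫ composePath ((δ ⋙q S.univMod).mapPath p) := by
  induction p with
  | nil => exact (Category.comp_id _).symm
  | cons p e ih =>
    exact (genArrow_map (δ.map e) _).trans
      ((congrArg (· ≫ S.univMod.map (δ.map e)) ih).trans (Category.assoc _ _ _))

/-- Diagrams commute and cones have unique fill-ins because this is so for `univMod`. The only
further point is that the fill-in of a family of denoted arrows is again denoted, which is what the
constructor `fill` provides. -/
theorem genPre_isModel (X : S.Theory) : S.IsModel (genPre X) := by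
  refine ⟨fun d i j p q => ?_, fun c => ?_⟩
  · ext k
    exact genArrow_injective ((genArrow_composePath (S.diag d) p k).trans
      ((congrArg (genArrow k ≫ ·) (S.univMod_isModel.1 d i j p q)).trans
        (genArrow_composePath (S.diag d) q k).symm))
  · have hc := S.univMod_isModel.2 c
    rw [GCone.isLimit_type_iff]
    refine ⟨fun i j a => ?_, fun x hx => ?_⟩
    · ext k
      refine genArrow_injective ?_
      refine (genArrow_map ((S.coneBase c).map a) _).trans ?_
      refine (congrArg (· ≫ _) (genArrow_map ((S.cone c).proj i) k)).trans ?_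
      refine Eq.trans ?_ (genArrow_map ((S.cone c).proj j) k).symm
      exact (Category.assoc _ _ _).trans (congrArg (genArrow k ≫ ·) (hc.1 i j a))
    · obtain ⟨h, hh, hh'⟩ := hc.2 ⟨X, fun i => genArrow (x i)⟩ fun i j a =>
        (genArrow_map ((S.coneBase c).map a) (x i)).symm.trans (congrArg genArrow (hx i j a))
      choose t ht using fun i => genArrow_denoted (x i)
      refine ⟨genMk h ⟨.fill c t, fun i => ?_⟩, fun i => genArrow_injective ?_, fun z hz => ?_⟩
      · exact Eq.mpr (congrArg (t i).Denotes (hh i)) (ht i)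
      · exact (genArrow_map ((S.cone c).proj i) _).trans
          ((congrArg (· ≫ _) (genArrow_genMk h _)).trans (hh i))
      · refine genArrow_injective (Eq.trans ?_ (genArrow_genMk h _).symm)
        exact hh' _ fun i => (genArrow_map ((S.cone c).proj i) z).symm.trans
          (congrArg genArrow (hz i))

/-- The model generated by `X`. -/
noncomputable def genModel (X : S.Theory) : S.SetModel := ⟨genPre X, genPre_isModel X⟩

/-- The generic element of `lim (M ∘ X)`, with `M` the model generated by `X`. -/
noncomputable def genSec (X : S.Theory) : Sec (genModel X) X :=
  ⟨fun i => genMk (X.proj i) ⟨.var i, rfl⟩, fun i j a => by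
    obtain ⟨f, hf⟩ := X.exists_arrow a
    rw [hf]
    refine genArrow_injective ((genArrow_map f _).trans ?_)
    exact (congrArg (· ≫ S.univMod.map f) (genArrow_genMk _ _)).trans
      ((X.proj_comp hf).trans (genArrow_genMk _ _).symm)⟩

/-- The morphism from the model generated by `X` that an element of `lim (M ∘ X)` induces. -/
noncomputable def genEval {X : S.Theory} {M : S.SetModel} (x : Sec M X) :
    SetModelHom (genModel X) M where
  app _ k := Theory.val (genArrow k) M x
  naturality f k := by
    rw [← Theory.val_comp_univMod]
    exact congrArg (fun g => Theory.val g M x) (genArrow_map f k)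

theorem genEval_genSec {X : S.Theory} {M : S.SetModel} (x : Sec M X) :
    (genEval x).sec X (genSec X) = x :=
  Subtype.ext <| funext fun i =>
    congrArg (fun g => Theory.val g M x) (genArrow_genMk (X.proj i) ⟨.var i, rfl⟩)

/-- Every arrow to a node is generated by the projections under the arrows and cones of `S`. -/
theorem exists_denotes {X : S.Theory} {n : S.Node} (g : X ⟶ S.univMod.obj n) :
    ∃ t : GenTerm X n, t.Denotes g := by
  -- The Yoneda argument: `g` agrees with the generated arrow that is its own value at the generic
  -- element.
  have h : g = genArrow (X := X) (Theory.val g (genModel X) (genSec X)) :=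
    Theory.hom_single_ext fun M x => by
      conv_lhs => rw [← genEval_genSec x]
      exact Theory.val_naturality g (genEval x) (genSec X)
  rw [h]
  exact genArrow_denoted _

/-- Induction on the arrows from an object of the theory to the nodes. -/
theorem hom_node_induction {X : S.Theory} {P : ∀ n : S.Node, (X ⟶ S.univMod.obj n) → Prop}
    (proj : ∀ i, P (X.label i) (X.proj i))
    (arr : ∀ {a b : S.Node} (f : a ⟶ b) (g : X ⟶ S.univMod.obj a),
      P a g → P b (g ≫ S.univMod.map f))
    (fill : ∀ (c : S.ConeIdx) (g : X ⟶ S.univMod.obj (S.cone c).vertex),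
      (∀ i, P _ (g ≫ S.univMod.map ((S.cone c).proj i))) → P _ g)
    {n : S.Node} (g : X ⟶ S.univMod.obj n) : P n g := by
  obtain ⟨t, ht⟩ := exists_denotes g
  induction t with
  | var i => exact ht ▸ proj i
  | app f t ih =>
    obtain ⟨k, hk, rfl⟩ := ht
    exact arr f k (ih k hk)
  | fill c t ih => exact fill c g fun i => ih i _ (ht i)

/-! ### The rules construct everything -/

theorem constrArr_diagram (L : S.CanonicalLimits) (X : S.Theory) (i j : X.shape.Node)
    (a : i ⟶ j) : ConstrArr L (X.diagram.map a) := by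
  obtain ⟨f, hf⟩ := X.exists_arrow a
  rw [show X.diagram.map a = S.univMod.map f from congrArg S.imIncl.map hf]
  exact .arr f

/-- By `L.formal`, `X` is the vertex of the canonical limit cone over a diagram of nodes and arrows
of `S`, so `∃LIM` applies. -/
theorem constrOb (L : S.CanonicalLimits) (X : S.Theory) : ConstrOb L X := by
  have h := ConstrOb.lim X.diagram (fun i => ConstrOb.ob (L := L) (X.label i))
    (constrArr_diagram L X) _ (.lim _)
  rw [L.formal] at h
  exact h

/-- An arrow to the vertex of a canonical limit cone is constructed if its composites with the
projections are. -/
theorem constrArr_of_comp_proj (L : S.CanonicalLimits) {I : FinGraph} {δ : I.Node ⥤q S.Theory}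
    (harr : ∀ (i j : I.Node) (a : i ⟶ j), ConstrArr L (δ.map a))
    {c : GCone δ} (hc : IsCanonical L c) (hcomm : c.Commutes) {X : S.Theory} (g : X ⟶ c.vertex)
    (hg : ∀ i, ConstrArr L (g ≫ c.proj i)) : ConstrArr L g := by
  refine .fillin δ (fun i => constrOb L _) harr c hc ⟨X, fun i => g ≫ c.proj i⟩ (constrOb L X)
    hg (fun i j a => ?_) g fun _ => rfl
  -- `COMPDIAG` alone derives the commutativity: the composite of the two arrows already equals the
  -- projection of the cone as an arrow of the theory.
  have h := ConstrComm.compdiag _ _ (hg i) (harr i j a)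
  rw [Category.assoc, hcomm i j a] at h
  exact h

/-- The three ways of generating arrows to nodes match the rules `∃LIM`, `∃COMP` with `∃ARR`, and
`∃FIA` for the cones of `S`. -/
theorem constrArr_node (L : S.CanonicalLimits) {X : S.Theory} {n : S.Node}
    (g : X ⟶ S.univMod.obj n) : ConstrArr L g := by
  refine hom_node_induction (P := fun n g => ConstrArr L g) (fun i => ?_)
    (fun f g hg => .comp _ _ hg (.arr f)) (fun c g hg => ?_) g
  · have h := ConstrArr.proj X.diagram (fun i => constrOb L _) (constrArr_diagram L X) _ (.lim _) i
    rw [L.formal] at h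
    exact h
  · exact constrArr_of_comp_proj L (fun i j a => .arr _) (.sketch c) (S.univMod_isModel.2 c).1 g hg

theorem constrArr (L : S.CanonicalLimits) {X Y : S.Theory} (f : X ⟶ Y) : ConstrArr L f := by
  have hY : IsCanonical L Y.formalCone := L.formal Y ▸ .lim _
  exact constrArr_of_comp_proj L (constrArr_diagram L Y) hY Y.formalCone_isLimit.1 f
    fun i => constrArr_node L (n := Y.label i) _

/-! ### Functors out of the theory -/

/-- The images of the projections under a finite-limit-preserving functor are jointly monic. -/
theorem _root_.PreservesFinLim.hom_ext {G : S.Theory ⥤ Type u} (hG : PreservesFinLim G)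
    {X : S.Theory} {A : Type u} {f g : A ⟶ G.obj X}
    (h : ∀ i, f ≫ G.map (X.proj i) = g ≫ G.map (X.proj i)) : f = g :=
  (hG _ _ _ X.formalCone_isLimit).hom_ext h

/-- The universal property of the image of an object under a finite-limit-preserving functor. -/
theorem _root_.PreservesFinLim.exists_lift {G : S.Theory ⥤ Type u} (hG : PreservesFinLim G)
    {X : S.Theory} {A : Type u} (k : ∀ i, A ⟶ G.obj (S.univMod.obj (X.label i)))
    (hk : ∀ {i j : X.shape.Node} {a : i ⟶ j} {f : X.label i ⟶ X.label j},
      X.diag.map a = S.toIm.map f → k i ≫ G.map (S.univMod.map f) = k j) :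
    ∃ h : A ⟶ G.obj X, ∀ i, h ≫ G.map (X.proj i) = k i :=
  ((hG _ _ _ X.formalCone_isLimit).2 ⟨A, k⟩ fun i j a => by
    obtain ⟨f, hf⟩ := X.exists_arrow a
    exact (congrArg (fun e => k i ≫ G.map (S.imIncl.map e)) hf).trans (hk hf)).exists

/-- A family of functions on the nodes that is compatible with the arrows of `S` extends to a
natural transformation between finite-limit-preserving functors. -/
theorem exists_natTrans {F G : S.Theory ⥤ Type u}
    (hG : PreservesFinLim G) (φ : ∀ n : S.Node, F.obj (S.univMod.obj n) ⟶ G.obj (S.univMod.obj n))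
    (hφ : ∀ {a b : S.Node} (f : a ⟶ b),
      F.map (S.univMod.map f) ≫ φ b = φ a ≫ G.map (S.univMod.map f)) :
    ∃ Φ : F ⟶ G, ∀ (X : S.Theory) (i : X.shape.Node),
      Φ.app X ≫ G.map (X.proj i) = F.map (X.proj i) ≫ φ (X.label i) := by
  choose Φ hΦ using fun X : S.Theory => hG.exists_lift (X := X)
    (fun i => F.map (X.proj i) ≫ φ (X.label i)) fun {i j a f} hf => by
      rw [Category.assoc, ← hφ, ← Category.assoc, ← F.map_comp, X.proj_comp hf]
  have key : ∀ {X : S.Theory} {n : S.Node} (g : X ⟶ S.univMod.obj n),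
      F.map g ≫ φ n = Φ X ≫ G.map g := fun {X n} g => by
    refine hom_node_induction (P := fun n g => F.map g ≫ φ n = Φ X ≫ G.map g)
      (fun i => (hΦ X i).symm) (fun f g hg => ?_) (fun c g hg => ?_) g
    · rw [F.map_comp, G.map_comp, Category.assoc, hφ, ← Category.assoc, hg, Category.assoc]
    -- `G` preserves the limit cone `univMod` makes of `c`, so equality can be tested on its
    -- projections, where the induction hypothesis applies.
    · refine (hG _ _ _ (S.univMod_isModel.2 c)).hom_ext fun i => ?_
      change (F.map g ≫ φ _) ≫ G.map (S.univMod.map ((S.cone c).proj i)) =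
        (Φ X ≫ G.map g) ≫ G.map (S.univMod.map ((S.cone c).proj i))
      rw [Category.assoc, ← hφ, ← Category.assoc, ← F.map_comp, hg i, G.map_comp, Category.assoc]
  refine ⟨⟨Φ, fun X Y f => hG.hom_ext fun i => ?_⟩, hΦ⟩
  rw [Category.assoc, hΦ, ← Category.assoc, ← F.map_comp, key, G.map_comp, Category.assoc]

/-- Finite-limit-preserving functors on the theory are determined by their restrictions to `S`. -/
theorem nonempty_iso_of_univMod {F G : S.Theory ⥤ Type u} (hF : PreservesFinLim F)
    (hG : PreservesFinLim G) (φ : ∀ n : S.Node, F.obj (S.univMod.obj n) ≅ G.obj (S.univMod.obj n))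
    (hφ : ∀ {a b : S.Node} (f : a ⟶ b),
      F.map (S.univMod.map f) ≫ (φ b).hom = (φ a).hom ≫ G.map (S.univMod.map f)) :
    Nonempty (F ≅ G) := by
  obtain ⟨Φ, hΦ⟩ := exists_natTrans hG (fun n => (φ n).hom) hφ
  obtain ⟨Ψ, hΨ⟩ := exists_natTrans hF (fun n => (φ n).inv) fun {a b} f => by
    rw [Iso.eq_inv_comp, ← Category.assoc, ← hφ f, Category.assoc, Iso.hom_inv_id,
      Category.comp_id]
  refine ⟨⟨Φ, Ψ, ?_, ?_⟩⟩
  · ext1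
    funext X
    refine hF.hom_ext fun i => ?_
    change (Φ.app X ≫ Ψ.app X) ≫ F.map (X.proj i) = 𝟙 _ ≫ F.map (X.proj i)
    rw [Category.assoc, hΨ, ← Category.assoc, hΦ, Category.assoc, Iso.hom_inv_id,
      Category.comp_id, Category.id_comp]
  · ext1
    funext X
    refine hG.hom_ext fun i => ?_
    change (Ψ.app X ≫ Φ.app X) ≫ G.map (X.proj i) = 𝟙 _ ≫ G.map (X.proj i)
    rw [Category.assoc, hΦ, ← Category.assoc, hΨ, Category.assoc, Iso.inv_hom_id,
      Category.comp_id, Category.id_comp]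

/-! ### Definable relations

A context assigns to each node of `S` a type of variables of that sort. A relation on the
assignments of a context in the models is definable if it consists of the restrictions of the
solutions of a finite system of equations in a larger finite context, where the values of the
auxiliary variables are determined by those of the given ones. -/

/-- The assignments of values in a model to the variables of a context. -/
abbrev Asg (M : S.SetModel) (V : S.Node → Type) : Type u := ∀ n, V n → M.toPre.obj n

/-- Restriction of an assignment along a map of contexts. -/
def Asg.comap {M : S.SetModel} {V W : S.Node → Type} (σ : ∀ n, V n → W n) (z : Asg M W) :
    Asg M V :=
  fun n x => z n (σ n x)

/-- The equations between variables. -/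
inductive Eqn (V : S.Node → Type) : Type u
  | edge {a b : S.Node} (f : a ⟶ b) (x : V a) (y : V b) : Eqn V
  | eq {a : S.Node} (x y : V a) : Eqn V

/-- The assignment satisfies the equation. -/
def Eqn.Holds {V : S.Node → Type} {M : S.SetModel} (z : Asg M V) : Eqn V → Prop
  | .edge f x y => M.toPre.map f (z _ x) = z _ y
  | .eq x y => z _ x = z _ y

/-- Renaming of variables in an equation. -/
def Eqn.map {V W : S.Node → Type} (σ : ∀ n, V n → W n) : Eqn V → Eqn W
  | .edge f x y => .edge f (σ _ x) (σ _ y)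
  | .eq x y => .eq (σ _ x) (σ _ y)

theorem Eqn.holds_map {V W : S.Node → Type} (σ : ∀ n, V n → W n) {M : S.SetModel}
    (z : Asg M W) (c : Eqn V) : (c.map σ).Holds z ↔ c.Holds (z.comap σ) := by
  cases c <;> rfl

/-- The solutions of a system of equations. -/
def solutions {V : S.Node → Type} (C : Set (Eqn V)) (M : S.SetModel) : Set (Asg M V) :=
  { z | ∀ c ∈ C, c.Holds z }

/-- The relation is defined by a finite system of equations, with auxiliary variables that are
determined by the given ones. -/
def Definable {V : S.Node → Type} (R : ∀ M : S.SetModel, Asg M V → Prop) : Prop :=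
  ∃ T : S.Node → Type, Finite (Σ n, T n) ∧ ∃ (σ : ∀ n, V n → T n) (C : Set (Eqn T)), C.Finite ∧
    ∀ M, Set.BijOn (Asg.comap σ) (solutions C M) { x | R M x }

theorem Definable.congr {V : S.Node → Type} {R R' : ∀ M : S.SetModel, Asg M V → Prop}
    (h : Definable R) (hR : ∀ M x, R' M x ↔ R M x) : Definable R' := by
  have : R' = R := funext fun M => funext fun x => propext (hR M x)
  rwa [this]

theorem definable_eqn {V : S.Node → Type} [hV : Finite (Σ n, V n)] (c : Eqn V) :
    Definable fun _ x => c.Holds x :=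
  ⟨V, hV, fun _ => id, {c}, Set.finite_singleton c, fun M => by
    have h : solutions {c} M = { x : Asg M V | c.Holds x } := Set.ext fun x =>
      ⟨fun h => h c rfl, fun h _ hc => Set.mem_singleton_iff.1 hc ▸ h⟩
    rw [h]
    exact Set.bijOn_id _⟩

/-- The systems are placed side by side over one common copy of `V`, with equations that identify
each given variable with its copy in every system. Keeping `V` itself as a summand also covers an
empty `K`. -/
theorem definable_forall {V : S.Node → Type} [Finite (Σ n, V n)] {K : Type} [Finite K]
    {R : K → ∀ M : S.SetModel, Asg M V → Prop} (h : ∀ k, Definable (R k)) :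
    Definable fun M x => ∀ k, R k M x := by
  choose T hT σ C hC hbij using h
  let ι : ∀ k n, T k n → V n ⊕ (Σ k, T k n) := fun k n t => .inr ⟨k, t⟩
  let C' : Set (Eqn fun n => V n ⊕ (Σ k, T k n)) :=
    (⋃ k, Eqn.map (ι k) '' C k) ∪
      Set.range fun p : K × Σ n, V n => .eq (.inl p.2.2) (ι p.1 _ (σ p.1 _ p.2.2))
  have hsol : ∀ M (z : Asg M fun n => V n ⊕ (Σ k, T k n)), z ∈ solutions C' M ↔
      ∀ k, z.comap (ι k) ∈ solutions (C k) M ∧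
        (z.comap (ι k)).comap (σ k) = z.comap fun _ => Sum.inl := fun M z => by
    refine ⟨fun hz k => ⟨fun c hc => ?_, ?_⟩, fun hz c hc => ?_⟩
    · rw [← Eqn.holds_map]
      exact hz _ (.inl (Set.mem_iUnion.2 ⟨k, c, hc, rfl⟩))
    · funext n v
      exact (hz _ (.inr ⟨(k, ⟨n, v⟩), rfl⟩)).symm
    · obtain hc | ⟨p, rfl⟩ := hc
      · obtain ⟨k, c, hck, rfl⟩ := Set.mem_iUnion.1 hc
        rw [Eqn.holds_map]
        exact (hz k).1 c hck
      · exact (congrFun (congrFun (hz p.1).2 p.2.1) p.2.2).symm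
  refine ⟨fun n => V n ⊕ (Σ k, T k n), ?_, fun _ => .inl, C', ?_, fun M => ⟨?_, ?_, ?_⟩⟩
  · refine Finite.of_surjective (α := (Σ n, V n) ⊕ (Σ k, Σ n, T k n))
      (Sum.elim (fun p => ⟨p.1, .inl p.2⟩) fun p => ⟨p.2.1, .inr ⟨p.1, p.2.2⟩⟩) ?_
    rintro ⟨n, v | ⟨k, t⟩⟩
    · exact ⟨.inl ⟨n, v⟩, rfl⟩
    · exact ⟨.inr ⟨k, n, t⟩, rfl⟩
  · exact (Set.finite_iUnion fun k => (hC k).image _).union (Set.finite_range _)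
  · intro z hz k
    rw [hsol] at hz
    rw [← (hz k).2]
    exact (hbij k M).mapsTo (hz k).1
  · intro z hz z' hz' h
    rw [hsol] at hz hz'
    funext n t
    obtain v | ⟨k, t⟩ := t
    · exact congrFun (congrFun h n) v
    · have : z.comap (ι k) = z'.comap (ι k) := (hbij k M).injOn (hz k).1 (hz' k).1 <| by
        rw [(hz k).2, (hz' k).2]
        exact h
      exact congrFun (congrFun this n) t
  · intro x hx
    choose z hz hzx using fun k => (hbij k M).surjOn (hx k)
    exact ⟨fun n t => t.elim (x n) fun q : Σ k, T k n => z q.1 n q.2,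
      (hsol _ _).2 fun k => ⟨hz k, hzx k⟩, rfl⟩

theorem Definable.and {V : S.Node → Type} [Finite (Σ n, V n)]
    {R R' : ∀ M : S.SetModel, Asg M V → Prop} (h : Definable R) (h' : Definable R') :
    Definable fun M x => R M x ∧ R' M x :=
  (definable_forall (K := Bool) (R := fun k => bif k then R else R') fun k => by
    cases k <;> assumption).congr fun M x => by simp [and_comm]

/-- No equation changes: the forgotten variables merely become auxiliary. The injectivity hypothesis
keeps them determined by the remaining ones. -/
theorem Definable.exists_comap {V W : S.Node → Type} {R : ∀ M : S.SetModel, Asg M W → Prop}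
    (h : Definable R) (τ : ∀ n, V n → W n)
    (hinj : ∀ M (z z' : Asg M W), R M z → R M z' → z.comap τ = z'.comap τ → z = z') :
    Definable fun M x => ∃ z, R M z ∧ z.comap τ = x := by
  obtain ⟨T, hT, σ, C, hC, hbij⟩ := h
  exact ⟨T, hT, fun n x => σ n (τ n x), C, hC, fun M =>
    Set.BijOn.comp (g := Asg.comap τ) (t := { z | R M z })
      (p := { x | ∃ z, R M z ∧ z.comap τ = x })
      ⟨fun z hz => ⟨z, hz, rfl⟩, fun z hz z' hz' h => hinj M z z' hz hz' h, fun x hx => hx⟩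
      (hbij M)⟩

/-! ### Definable relations are represented by objects of the theory -/

/-- The assignment given by arrows of the theory. -/
def asgOf {V : S.Node → Type} {Z : S.Theory} (π : ∀ n, V n → (Z ⟶ S.univMod.obj n))
    (M : S.SetModel) (z : Sec M Z) : Asg M V :=
  fun n x => Theory.val (π n x) M z

/-- The `i`-th projection, with the node that it goes to given up to equality. -/
def Theory.projTo (X : S.Theory) {i : X.shape.Node} {n : S.Node} (h : X.label i = n) :
    X ⟶ S.univMod.obj n :=
  h ▸ X.proj i

theorem Theory.val_projTo_heq (X : S.Theory) {i : X.shape.Node} {n : S.Node}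
    (h : X.label i = n) (M : S.SetModel) (x : Sec M X) :
    HEq (Theory.val (X.projTo h) M x) (x.1 i) := by
  subst h
  rfl

/-- The finite diagram with the given variables as nodes and arrows of `S` between them. -/
noncomputable def systemObj {T : S.Node → Type} [Finite (Σ n, T n)]
    (E : ∀ {a b : S.Node}, (a ⟶ b) → T a → T b → Prop)
    (hE : ∀ {a b : S.Node} (x : T a) (y : T b), Finite { f : a ⟶ b // E f x y }) : S.Theory where
  shape :=
    { nodes := Nat.card (Σ n, T n)
      arrows := fun i j => Nat.card { f // E f ((Finite.equivFin (Σ n, T n)).symm i).2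
        ((Finite.equivFin (Σ n, T n)).symm j).2 } }
  diag :=
    { obj := fun i => ((Finite.equivFin (Σ n, T n)).symm i).1
      map := fun a => S.toIm.map ((@Finite.equivFin _ (hE _ _)).symm a).1 }

theorem exists_represents_edges {T : S.Node → Type} [Finite (Σ n, T n)]
    (E : ∀ {a b : S.Node}, (a ⟶ b) → T a → T b → Prop)
    (hE : ∀ {a b : S.Node} (x : T a) (y : T b), Finite { f : a ⟶ b // E f x y }) :
    ∃ (Z : S.Theory) (π : ∀ n, T n → (Z ⟶ S.univMod.obj n)), ∀ M,
      Set.BijOn (asgOf π M) Set.univ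
        { z | ∀ {a b : S.Node} (f : a ⟶ b) (x : T a) (y : T b), E f x y →
          M.toPre.map f (z a x) = z b y } := by
  let e := Finite.equivFin (Σ n, T n)
  let Z : S.Theory := systemObj E hE
  have hlabel : ∀ p : Σ n, T n, Z.label (e p) = p.1 := fun p =>
    congrArg Sigma.fst (e.symm_apply_apply p)
  let π : ∀ n, T n → (Z ⟶ S.univMod.obj n) := fun n x => Z.projTo (hlabel ⟨n, x⟩)
  have hπ : ∀ M (z : Sec M Z) (i : Z.shape.Node),
      asgOf π M z (e.symm i).1 (e.symm i).2 = z.1 i := fun M z i =>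
    eq_of_heq ((Z.val_projTo_heq _ M z).trans
      (congr_arg_heq z.1 (e.apply_symm_apply i)))
  refine ⟨Z, π, fun M => ⟨fun z _ a b f x y hf => ?_, fun z _ z' _ h => ?_, fun x hx => ?_⟩⟩
  -- With variables and sorts packed into pairs, each pair can be replaced by some `e.symm i`, whose
  -- sort is the label of `i` by definition, which avoids transport.
  · suffices h : ∀ (p q : Σ n, T n) (f : p.1 ⟶ q.1), E f p.2 q.2 →
        M.toPre.map f (asgOf π M z p.1 p.2) = asgOf π M z q.1 q.2 from h ⟨a, x⟩ ⟨b, y⟩ f hf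
    intro p q f hf
    obtain ⟨i, rfl⟩ := e.symm.surjective p
    obtain ⟨j, rfl⟩ := e.symm.surjective q
    have h := z.2 i j (@Finite.equivFin _ (hE _ _) ⟨f, hf⟩)
    refine (congrArg (M.toPre.map f) (hπ M z i)).trans (Eq.trans ?_ (h.trans (hπ M z j).symm))
    refine congrArg (fun g => M.toPre.map g (z.1 i)) ?_
    exact (congrArg Subtype.val ((@Finite.equivFin _ (hE _ _)).symm_apply_apply ⟨f, hf⟩)).symm
  · refine Subtype.ext (funext fun i => ?_)
    rw [← hπ, ← hπ, h]
  · refine ⟨⟨fun i => x (e.symm i).1 (e.symm i).2, fun i j a =>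
      hx _ _ _ ((@Finite.equivFin _ (hE _ _)).symm a).2⟩, trivial,
        funext fun n => funext fun t => ?_⟩
    exact eq_of_heq ((Z.val_projTo_heq _ M _).trans
      (congr_arg_heq (fun p : Σ n, T n => x p.1 p.2) (e.symm_apply_apply ⟨n, t⟩)))

/-- The solutions of a finite system of equations are represented by an object of the theory. -/
theorem exists_represents_solutions {T : S.Node → Type} [Finite (Σ n, T n)] {C : Set (Eqn T)}
    (hC : C.Finite) :
    ∃ (Z : S.Theory) (π : ∀ n, T n → (Z ⟶ S.univMod.obj n)), ∀ M,
      Set.BijOn (asgOf π M) Set.univ (solutions C M) := by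
  -- A diagram can only express equations along arrows of the graph, so variables that the system
  -- equates are merged into one node.
  let r : ∀ n, T n → T n → Prop := fun n x y => .eq x y ∈ C
  let mk : ∀ n, T n → Quot (r n) := fun n => Quot.mk (r n)
  let E : ∀ {a b : S.Node}, (a ⟶ b) → Quot (r a) → Quot (r b) → Prop := fun {a b} f q q' =>
    ∃ x y, .edge f x y ∈ C ∧ mk a x = q ∧ mk b y = q'
  have : Finite (Σ n, Quot (r n)) :=
    Finite.of_surjective (fun p : Σ n, T n => ⟨p.1, mk _ p.2⟩) fun ⟨n, q⟩ => by
      obtain ⟨x, rfl⟩ := Quot.exists_rep q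
      exact ⟨⟨n, x⟩, rfl⟩
  have hE : ∀ {a b : S.Node} (q : Quot (r a)) (q' : Quot (r b)), Finite { f // E f q q' } := by
    intro a b q q'
    choose x y h _ _ using fun f : { f // E f q q' } => f.2
    have := hC.to_subtype
    refine Finite.of_injective (β := C) (fun f => ⟨.edge f.1 (x f) (y f), h f⟩) fun f g hfg => ?_
    have := Subtype.mk.inj hfg
    simp only [Eqn.edge.injEq, heq_eq_eq, true_and] at this
    exact Subtype.ext this.1
  obtain ⟨Z, π, hπ⟩ := exists_represents_edges E hE
  refine ⟨Z, fun n x => π n (mk n x), fun M => Set.BijOn.comp (g := Asg.comap mk)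
    (p := solutions C M) ⟨fun z hz c hc => ?_, fun z _ z' _ h => ?_, fun z hz => ?_⟩ (hπ M)⟩
  · cases c with
    | edge f x y => exact hz f _ _ ⟨x, y, hc, rfl, rfl⟩
    | eq x y => exact congrArg (z _) (Quot.sound hc)
  · funext n q
    obtain ⟨x, rfl⟩ := Quot.exists_rep q
    exact congrFun (congrFun h n) x
  · refine ⟨fun n q => Quot.lift (z n) (fun x y h => hz (.eq x y) h) q, ?_, rfl⟩
    rintro a b f _ _ ⟨x, y, hc, rfl, rfl⟩
    exact hz _ hc

theorem Definable.exists_represents {V : S.Node → Type}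
    {R : ∀ M : S.SetModel, Asg M V → Prop} (h : Definable R) :
    ∃ (Z : S.Theory) (π : ∀ n, V n → (Z ⟶ S.univMod.obj n)), ∀ M,
      Set.BijOn (asgOf π M) Set.univ { x | R M x } := by
  obtain ⟨T, hT, σ, C, hC, hbij⟩ := h
  obtain ⟨Z, π, hπ⟩ := exists_represents_solutions hC
  exact ⟨Z, fun n x => π n (σ n x), fun M => (hbij M).comp (hπ M)⟩

/-! ### The graphs of the arrows of the theory are definable -/

/-- The context with a variable of sort `l k` for each `k`. -/
inductive Fam {K : Type} (l : K → S.Node) : S.Node → Type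
  | mk (k : K) : Fam l (l k)

/-- The assignment on `Fam l` with the given values. -/
def Fam.asg {K : Type} {l : K → S.Node} {M : S.SetModel} (x : ∀ k, M.toPre.obj (l k)) :
    Asg M (Fam l)
  | _, .mk k => x k

theorem Fam.asg_ext {K : Type} {l : K → S.Node} {M : S.SetModel} {x y : Asg M (Fam l)}
    (h : ∀ k, x _ (.mk k) = y _ (.mk k)) : x = y := by
  funext n t
  cases t with
  | mk k => exact h k

instance {K : Type} [Finite K] (l : K → S.Node) : Finite (Σ n, Fam l n) :=
  Finite.of_surjective (fun k => ⟨l k, .mk k⟩) fun ⟨_, .mk k⟩ => ⟨k, rfl⟩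

/-- The sum of two contexts. -/
abbrev SumCtx (V W : S.Node → Type) (n : S.Node) : Type := V n ⊕ W n

instance {V W : S.Node → Type} [Finite (Σ n, V n)] [Finite (Σ n, W n)] :
    Finite (Σ n, SumCtx V W n) :=
  Finite.of_surjective (α := (Σ n, V n) ⊕ (Σ n, W n))
    (Sum.elim (fun p => ⟨p.1, .inl p.2⟩) fun p => ⟨p.1, .inr p.2⟩) <| by
      rintro ⟨n, v | w⟩
      · exact ⟨.inl ⟨n, v⟩, rfl⟩
      · exact ⟨.inr ⟨n, w⟩, rfl⟩

instance (I : FinGraph) : Finite I.Node := inferInstanceAs (Finite (Fin I.nodes))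

instance (I : FinGraph) (i j : I.Node) : Finite (i ⟶ j) :=
  inferInstanceAs (Finite (Fin (I.arrows i j)))

/-- The variables `ξ` take the values of a compatible family over `X`. -/
def IsSec {V : S.Node → Type} {X : S.Theory} (ξ : ∀ i, V (X.label i)) (M : S.SetModel)
    (x : Asg M V) (s : Sec M X) : Prop :=
  ∀ i, s.1 i = x _ (ξ i)

theorem IsSec.unique {V : S.Node → Type} {X : S.Theory} {ξ : ∀ i, V (X.label i)}
    {M : S.SetModel} {x : Asg M V} {s s' : Sec M X} (h : IsSec ξ M x s) (h' : IsSec ξ M x s') :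
    s = s' :=
  Subtype.ext (funext fun i => (h i).trans (h' i).symm)

theorem definable_isSec {V : S.Node → Type} [Finite (Σ n, V n)] {X : S.Theory}
    (ξ : ∀ i, V (X.label i)) : Definable fun M x => ∃ s, IsSec ξ M x s := by
  choose f hf using fun p : Σ i j : X.shape.Node, (i ⟶ j) => X.exists_arrow p.2.2
  refine (definable_forall fun p : Σ i j : X.shape.Node, (i ⟶ j) =>
    definable_eqn (.edge (f p) (ξ p.1) (ξ p.2.1))).congr fun M x => ⟨?_, fun h => ?_⟩
  · rintro ⟨s, hs⟩ p
    have := s.2 _ _ p.2.2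
    rw [hf p, hs, hs] at this
    exact this
  · refine ⟨⟨fun i => x _ (ξ i), fun i j a => ?_⟩, fun i => rfl⟩
    rw [hf ⟨i, j, a⟩]
    exact h ⟨i, j, a⟩

/-- The variables `ξ` take the values of a compatible family over `X`, and `η` takes the value of
`g` at it. -/
def IsGraph {V : S.Node → Type} {X : S.Theory} {n : S.Node} (g : X ⟶ S.univMod.obj n)
    (ξ : ∀ i, V (X.label i)) (η : V n) (M : S.SetModel) (x : Asg M V) : Prop :=
  ∃ s, IsSec ξ M x s ∧ Theory.val g M s = x n η

/-- Composition with `f` needs one auxiliary variable, for the intermediate value. A fill-in needs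
one for each projection of its value; these are determined by `η`, and conversely the limit cone in
the model forces `η` to be the value of the fill-in. -/
theorem definable_isGraph {X : S.Theory} {n : S.Node} (g : X ⟶ S.univMod.obj n) :
    ∀ {V : S.Node → Type} [Finite (Σ n, V n)] (ξ : ∀ i, V (X.label i)) (η : V n),
      Definable (IsGraph g ξ η) := by
  refine hom_node_induction (P := fun n g => ∀ {V : S.Node → Type} [Finite (Σ n, V n)]
    (ξ : ∀ i, V (X.label i)) (η : V n), Definable (IsGraph g ξ η)) (fun i V _ ξ η => ?_)
    (fun {a b} f g hg V _ ξ η => ?_) (fun c g hg V _ ξ η => ?_) g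
  · refine ((definable_isSec ξ).and (definable_eqn (.eq (ξ i) η))).congr fun M x => ⟨?_, ?_⟩
    · rintro ⟨s, hs, h⟩
      exact ⟨⟨s, hs⟩, (hs i).symm.trans h⟩
    · rintro ⟨⟨s, hs⟩, h⟩
      exact ⟨s, hs, (hs i).trans h⟩
  · refine (((hg (V := SumCtx V (Fam fun _ : Unit => a)) (fun i => .inl (ξ i))
      (.inr (.mk ()))).and (definable_eqn (.edge f (.inr (.mk ())) (.inl η)))).exists_comap
        (fun _ => Sum.inl) ?_).congr fun M x => ⟨?_, ?_⟩
    · rintro M z z' ⟨⟨s, hs, h⟩, -⟩ ⟨⟨s', hs', h'⟩, -⟩ hzz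
      have hV : ∀ n v, z n (.inl v) = z' n (.inl v) := fun n v => congrFun (congrFun hzz n) v
      obtain rfl : s = s' := Subtype.ext (funext fun i =>
        (hs i).trans ((hV _ _).trans (hs' i).symm))
      funext n t
      obtain v | ⟨⟨⟩⟩ := t
      · exact hV n v
      · exact h.symm.trans h'
    · rintro ⟨s, hs, h⟩
      exact ⟨fun n t => t.elim (x n) (Fam.asg (fun _ => Theory.val g M s) n),
        ⟨⟨s, hs, rfl⟩, h⟩, rfl⟩
    · rintro ⟨z, ⟨⟨s, hs, h⟩, h'⟩, rfl⟩
      exact ⟨s, hs, (congrArg (M.toPre.map f) h).trans h'⟩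
  · have hM := fun M : S.SetModel => (GCone.isLimit_type_iff _).1 (M.isModel.2 c)
    -- `definable_isSec` is required separately, because a cone over the empty diagram contributes
    -- no graph conditions.
    refine ((((definable_isSec (V := SumCtx V (Fam (S.coneBase c).obj)) (X := X)
      (fun i => .inl (ξ i))).and (definable_forall fun k => hg k (fun i => .inl (ξ i))
        (.inr (.mk k)))).and (definable_forall fun k => definable_eqn
          (.edge ((S.cone c).proj k) (.inl η) (.inr (.mk k))))).exists_comap
            (fun _ => Sum.inl) ?_).congr fun M x => ⟨?_, ?_⟩
    · rintro M z z' ⟨-, h⟩ ⟨-, h'⟩ hzz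
      have hV : ∀ n v, z n (.inl v) = z' n (.inl v) := fun n v => congrFun (congrFun hzz n) v
      funext n t
      obtain v | t := t
      · exact hV n v
      · obtain ⟨k⟩ := t
        exact (h k).symm.trans ((congrArg _ (hV _ η)).trans (h' k))
    · rintro ⟨s, hs, h⟩
      refine ⟨fun n t => t.elim (x n) (Fam.asg
        (fun k => M.toPre.map ((S.cone c).proj k) (x _ η)) n),
        ⟨⟨⟨s, hs⟩, fun k => ⟨s, hs, ?_⟩⟩, fun k => rfl⟩, rfl⟩
      exact congrArg (M.toPre.map ((S.cone c).proj k)) h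
    · rintro ⟨z, ⟨⟨⟨s, hs⟩, h⟩, h'⟩, rfl⟩
      refine ⟨s, hs, ((hM M).2 (fun k => z _ (.inr (.mk k))) fun i j a => ?_).unique
        (fun k => ?_) h'⟩
      · rw [← h' i, ← h' j]
        exact ConcreteCategory.congr_hom ((hM M).1 i j a) _
      · obtain ⟨s', hs', hk⟩ := h k
        obtain rfl := hs.unique hs'
        exact hk

/-! ### Finite limits in the theory -/

/-- Every finite diagram in the theory has a cone that all set-valued models take to a limit
cone. -/
theorem exists_evalAt_isLimit {I : FinGraph} (δ : I.Node ⥤q S.Theory) :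
    ∃ c : GCone δ, ∀ M : S.SetModel, (c.map (evalAt M).toPrefunctor).IsLimit := by
  let l : (Σ i : I.Node, (δ.obj i).shape.Node) → S.Node := fun p => (δ.obj p.1).label p.2
  let ξ : ∀ i k, Fam l ((δ.obj i).label k) := fun i k => .mk (l := l) ⟨i, k⟩
  -- The limit at `M` as a relation: a section of each `δ.obj i`, and for each arrow of `I` the
  -- components of its value, each of which is an arrow to a node.
  have hdef := (definable_forall fun i : I.Node => definable_isSec (ξ i)).and
    (definable_forall fun p : Σ i j : I.Node, (i ⟶ j) × (δ.obj j).shape.Node =>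
      definable_isGraph (δ.map p.2.2.1 ≫ (δ.obj p.2.1).proj p.2.2.2) (ξ p.1) (ξ p.2.1 p.2.2.2))
  obtain ⟨Z, π, hπ⟩ := hdef.exists_represents
  have hsec : ∀ M (z : Sec M Z) i, ∃ s, IsSec (ξ i) M (asgOf π M z) s := fun M z =>
    ((hπ M).mapsTo (Set.mem_univ z)).1
  let pr : ∀ i, Z ⟶ δ.obj i := fun i => TheoryHom.mk
    (fun M z => ⟨fun k => asgOf π M z _ (ξ i k), fun j k a => by
      obtain ⟨s, hs⟩ := hsec M z i
      exact (congrArg _ (hs j).symm).trans ((s.2 j k a).trans (hs k))⟩)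
    fun h z => Subtype.ext (funext fun k => Theory.val_naturality (π _ (ξ i k)) h z)
  have hpr : ∀ M (z : Sec M Z) i, IsSec (ξ i) M (asgOf π M z) (Theory.act (pr i) M z) :=
    fun M z i k => rfl
  refine ⟨⟨Z, pr⟩, fun M => (GCone.isLimit_type_iff _).2 ⟨fun i j a => ?_, fun x hx => ?_⟩⟩
  · ext z
    refine Subtype.ext (funext fun k => ?_)
    obtain ⟨s, hs, h⟩ := ((hπ M).mapsTo (Set.mem_univ z)).2 ⟨i, j, a, k⟩
    obtain rfl := hs.unique (hpr M z i)
    exact h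
  · let y : Asg M (Fam l) := Fam.asg fun p => (x p.1 : Sec M (δ.obj p.1)).1 p.2
    obtain ⟨z, -, hz⟩ := (hπ M).surjOn (show y ∈ _ from ⟨fun i => ⟨x i, fun k => rfl⟩, fun p =>
      ⟨x p.1, fun k => rfl, congrArg (fun s : Sec M (δ.obj p.2.1) => s.1 p.2.2.2)
        (hx p.1 p.2.1 p.2.2.1)⟩⟩)
    refine ⟨z, fun i => Subtype.ext (funext fun k => ?_), fun y hy => ?_⟩
    · exact congrFun (congrFun hz _) (ξ i k)
    · refine (hπ M).injOn (Set.mem_univ _) (Set.mem_univ _) (Eq.trans ?_ hz.symm)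
      refine Fam.asg_ext fun p => ?_
      exact congrArg (fun s : Sec M (δ.obj p.1) => s.1 p.2) (hy p.1)

/-- A functor preserves finite limits if it preserves a limit cone of every finite diagram. -/
theorem _root_.preservesFinLim_of_exists {C : Type w} [Category.{v} C] {D : Type w₁}
    [Category.{v₁} D] {F : C ⥤ D}
    (h : ∀ (I : FinGraph) (δ : I.Node ⥤q C), ∃ c : GCone δ,
      c.IsLimit ∧ (c.map F.toPrefunctor).IsLimit) : PreservesFinLim F := by
  intro I δ c hc
  obtain ⟨c₀, hc₀, hF⟩ := h I δ
  obtain ⟨f, hf, -⟩ := hc.2 c₀ hc₀.1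
  obtain ⟨g, hg, -⟩ := hc₀.2 c hc.1
  -- Only this half of the comparison isomorphism is needed: it makes `F.map f` a retraction of
  -- `F.map g`, which gives uniqueness of factorizations.
  have hgf : g ≫ f = 𝟙 _ := hc.hom_ext fun i => by
    rw [Category.assoc, hf, hg, Category.id_comp]
  refine ⟨fun i j a => ?_, fun t ht => ?_⟩
  · exact (F.map_comp _ _).symm.trans (congrArg F.map (hc.1 i j a))
  · obtain ⟨k, hk, hk'⟩ := hF.2 t ht
    have hFf : ∀ i, F.map f ≫ F.map (c.proj i) = F.map (c₀.proj i) := fun i => by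
      rw [← F.map_comp, hf]
    have hFg : ∀ i, F.map g ≫ F.map (c₀.proj i) = F.map (c.proj i) := fun i => by
      rw [← F.map_comp, hg]
    have hFgf : F.map g ≫ F.map f = 𝟙 _ := by rw [← F.map_comp, hgf, F.map_id]
    refine ⟨k ≫ F.map f, fun i => ?_, fun l hl => ?_⟩
    · exact (Category.assoc _ _ _).trans ((congrArg (k ≫ ·) (hFf i)).trans (hk i))
    · have hl' : l ≫ F.map g = k := hk' _ fun i =>
        (Category.assoc _ _ _).trans ((congrArg (l ≫ ·) (hFg i)).trans (hl i))
      exact (Category.comp_id l).symm.trans ((congrArg (l ≫ ·) hFgf.symm).trans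
        ((Category.assoc _ _ _).symm.trans (congrArg (· ≫ F.map f) hl')))

theorem evalAt_preservesFinLim (M : S.SetModel) : PreservesFinLim (evalAt M) :=
  preservesFinLim_of_exists fun _ δ =>
    (exists_evalAt_isLimit δ).imp fun c hc => ⟨isLimit_of_evalAt c hc, hc M⟩

/-- The evaluation at `M` of the theory restricts to `M`. -/
def evalAtUnivModIso (M : S.SetModel) (n : S.Node) :
    (evalAt M).obj (S.univMod.obj n) ≅ M.toPre.obj n where
  hom := ↾fun x : Sec M (S.single n) => x.1 FinGraph.pointNode
  inv := ↾fun x => secSingle (n := n) M x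
  hom_inv_id := by
    ext x
    exact secSingle_eta (n := n) x
  inv_hom_id := rfl

theorem isCategorialTheory (S : FinLimSketch.{u}) : S.IsCategorialTheory S.univMod where
  hasLimits _ δ := (exists_evalAt_isLimit δ).imp isLimit_of_evalAt
  isModel := S.univMod_isModel
  extend M := ⟨evalAt M, evalAt_preservesFinLim M, evalAtUnivModIso M, fun _ => rfl⟩
  unique _ _ hF hG := fun ⟨φ, hφ⟩ => nonempty_iso_of_univMod hF hG φ hφ

/-! ### Canonical limits -/

theorem single_injective : Function.Injective S.single := fun m n h => by
  obtain ⟨-, h⟩ := Theory.mk.inj h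
  exact congrArg (fun d : FinGraph.point.Node ⥤q S.ImNode => d.obj FinGraph.pointNode)
    (eq_of_heq h)

/-- This is where the identification of arrows in the image graph matters: without it, distinct
objects could have the same diagram in the theory, and `CanonicalLimits.formal` would impose
conflicting choices. -/
theorem imIncl_map_injective {a b : S.ImNode} :
    Function.Injective (S.imIncl.map : (a ⟶ b) → _) := fun e e' h => by
  induction e using Quotient.inductionOn with | h f => ?_
  induction e' using Quotient.inductionOn with | h f' => ?_
  refine Quotient.sound fun M => ?_
  ext x
  exact congrArg (fun g => Theory.val (n := b) g M (secSingle (n := a) M x)) h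

/-- A diagram in the image graph is determined by its image in the theory. -/
theorem comp_imIncl_injective {J : Type*} [Quiver J] {d d' : J ⥤q S.ImNode}
    (h : d ⋙q S.imIncl = d' ⋙q S.imIncl) : d = d' := by
  obtain ⟨o, m⟩ := d
  obtain ⟨o', m'⟩ := d'
  obtain rfl : o = o' := funext fun i => single_injective (Prefunctor.congr_obj h i)
  obtain ⟨-, h⟩ := Prefunctor.mk.inj h
  congr
  funext i j a
  exact imIncl_map_injective (congrFun (congrFun (congrFun (eq_of_heq h) i) j) a)

theorem Theory.eq_of_diagram_eq {X Y : S.Theory}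
    (h : (⟨X.shape, X.diagram⟩ : Σ I : FinGraph, I.Node ⥤q S.Theory) = ⟨Y.shape, Y.diagram⟩) :
    X = Y := by
  obtain ⟨I, d⟩ := X
  obtain ⟨J, d'⟩ := Y
  obtain ⟨rfl, h⟩ := Sigma.mk.inj h
  exact congrArg (Theory.mk I) (comp_imIncl_injective (eq_of_heq h))

/-- The cone is prescribed if `δ` is the diagram of an object, which is then unique; otherwise any
limit cone will do. The equality is heterogeneous because the shape and base of the two cones agree
only by the hypothesis. -/
theorem exists_canonical {I : FinGraph} (δ : I.Node ⥤q S.Theory) :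
    ∃ c : GCone δ, c.IsLimit ∧ ∀ X : S.Theory,
      (⟨X.shape, X.diagram⟩ : Σ I : FinGraph, I.Node ⥤q S.Theory) = ⟨I, δ⟩ →
        HEq c X.formalCone := by
  by_cases h : ∃ X : S.Theory,
      (⟨X.shape, X.diagram⟩ : Σ I : FinGraph, I.Node ⥤q S.Theory) = ⟨I, δ⟩
  · obtain ⟨X, hX⟩ := h
    cases hX
    refine ⟨X.formalCone, X.formalCone_isLimit, fun Y hY => ?_⟩
    cases Theory.eq_of_diagram_eq hY
    rfl
  · obtain ⟨c, hc⟩ := exists_evalAt_isLimit δ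
    exact ⟨c, isLimit_of_evalAt c hc, fun X hX => (h ⟨X, hX⟩).elim⟩

theorem nonempty_canonicalLimits (S : FinLimSketch.{u}) : Nonempty S.CanonicalLimits := by
  choose c hc hc' using @exists_canonical S
  exact ⟨⟨c, hc, fun X => eq_of_heq (hc' X.diagram X rfl)⟩⟩

end FinLimSketch

theorem proposition4p1p1 (S : FinLimSketch.{u}) :
    S.IsCategorialTheory S.univMod ∧
    Nonempty S.CanonicalLimits ∧
    ∀ L : S.CanonicalLimits,
      (∀ X : S.Theory, FinLimSketch.ConstrOb L X) ∧
      (∀ (X Y : S.Theory) (f : X ⟶ Y), FinLimSketch.ConstrArr L f) :=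
  ⟨S.isCategorialTheory, S.nonempty_canonicalLimits, fun L =>
    ⟨FinLimSketch.constrOb L, fun _ _ => FinLimSketch.constrArr L⟩⟩
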